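/- Let $B$ be a von Neumann algebra, let $(A_i)_{i\in I}$ be a family of von Neumann algebras each containing $B$ as a unital subalgebra, and let $E_i:A_i\to B$ be normal faithful conditional expectations. Let $\mathring A_i=\{a\in A_i: E_i(a)=0\}$, let $\mathcal H_i$ be the Hilbert $B$-module obtained by completing $\mathring A_i$ for the $B$-valued inner product $\langle x,y\rangle=E_i(x^*y)$, with left multiplication by $B$, and let $$\mathcal H=B\oplus\bigoplus_{n\ge1,\ i_1\ne i_2\ne\cdots\ne i_n}\mathcal H_{i_1}\otimes_B\cdots\otimes_B\mathcal H_{i_n}$$ be the Fock (right Hilbert $B$-) module, where $$\langle a_1\otimes w,\ a_1'\otimes w'\rangle=\langle w,E_i(a_1^*a_1')w'\rangle\qquad(a_1,a_1'\in\mathring A_i)$$ and summands with different index strings are orthogonal. Let $\mathcal L(\mathcal H)$ be the algebra of adjointable operators on $\mathcal H$ with the operator norm, and let $\pi_i:A_i\to\mathcal L(\mathcal H)$ be the $*$-homomorphism of the reduced amalgamated free product: for $a\in A_i$, $h\in\mathring A_i$ and an elementary tensor $w$ (possibly of length $0$, i.e. $w\in B$) which does not begin with a factor from $\mathcal H_i$,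 $$\pi_i(a)w=(a-E_i(a))\otimes w+E_i(a)w,\qquad \pi_i(a)(h\otimes w)=(ah-E_i(ah))\otimes w+E_i(ah)w .$$ Let $a_i\in\mathring A_i$ $(i\in I)$ be such that only finitely many $a_i$ are different from $0$. Then $$\Big\|\sum_i\pi_i(a_i)\Big\|\le\sup_i\|a_i\|+\Big\|\sum_iE_i(a_i^*a_i)\Big\|^{1/2}+\Big\|\sum_iE_i(a_ia_i^*)\Big\|^{1/2}.$$ -/

import Mathlib

set_option linter.unusedSectionVars false

/-! ### Positive definite kernels with values in a C*-algebra -/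

namespace FreeProduct

theorem exists_negative_conjugate {M : Type*} [CStarAlgebra M] {x : M} (hx : star x = x) :
    ∃ N D : M, star N * x * N = -(star D * D) ∧ (D = 0 → ∃ C : M, x = star C * C) := by
  let _ := CStarAlgebra.spectralOrder M
  let _ := CStarAlgebra.spectralOrderedRing M
  have hM : IsSelfAdjoint x := hx
  have hN : 0 ≤ x⁻ := CFC.negPart_nonneg x
  have hNs : star x⁻ = x⁻ := (IsSelfAdjoint.of_nonneg hN).star_eq
  obtain ⟨D, hD⟩ := CStarAlgebra.nonneg_iff_eq_star_mul_self.mp (star_left_conjugate_nonneg hN x⁻)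
  refine ⟨x⁻, D, ?_, fun hD0 => ?_⟩
  · rw [← hD]
    conv_lhs => enter [1, 2]; rw [← CFC.posPart_sub_negPart x hM]
    rw [mul_sub, sub_mul, hNs, CFC.negPart_mul_posPart]; simp
  · have hN3 : x⁻ * x⁻ * x⁻ = 0 := by
      rw [hNs] at hD; rw [hD, hD0]; simp
    have hN2 : x⁻ * x⁻ = 0 := by
      rw [← CStarRing.star_mul_self_eq_zero_iff, star_mul, hNs, ← mul_assoc, hN3, zero_mul]
    have hN1 : x⁻ = 0 := by
      rw [← CStarRing.star_mul_self_eq_zero_iff, hNs, hN2]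
    apply CStarAlgebra.nonneg_iff_eq_star_mul_self.mp
    rw [← CFC.posPart_sub_negPart x hM, hN1, sub_zero]
    exact CFC.posPart_nonneg x

/-- A finite kernel `c` with values in `B` is hermitian and positive definite. -/
def IsPosKernel {B J : Type*} [CStarAlgebra B] [PartialOrder B] [Fintype J] (c : J → J → B) :
    Prop :=
  (∀ j k, star (c j k) = c k j) ∧ ∀ b : J → B, 0 ≤ ∑ j, ∑ k, star (b j) * c j k * b k

theorem IsPosKernel.exists_factor {B J : Type*} [CStarAlgebra B] [PartialOrder B]
    [StarOrderedRing B] [Fintype J] {c : J → J → B} (h : IsPosKernel c) :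
    ∃ C : J → J → B, ∀ j k, c j k = ∑ l, star (C l j) * C l k := by
  classical
  let M : CStarMatrix J J B := fun j k => c j k
  have hM : star M = M := by
    ext j k
    exact h.1 k j
  obtain ⟨N, D, hND, hC⟩ := exists_negative_conjugate hM
  have hD : D = 0 := by
    ext i k
    have h2 : ∑ j, ∑ l, star (N j k) * c j l * N l k = - ∑ j, star (D j k) * D j k := by
      have := congrFun (congrFun hND k) k
      simp only [CStarMatrix.mul_apply, Finset.sum_mul] at this
      rw [Finset.sum_comm]
      refine this.trans ?_
      exact congrArg Neg.neg (CStarMatrix.mul_apply (M := star D) (N := D))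
    have h1 := h.2 (fun j => N j k)
    rw [h2] at h1
    have h4 : ∀ j ∈ Finset.univ, 0 ≤ star (D j k) * D j k := fun j _ => star_mul_self_nonneg _
    have h5 := (Finset.sum_eq_zero_iff_of_nonneg h4).mp
      (le_antisymm (neg_nonneg.mp h1) (Finset.sum_nonneg h4)) i (Finset.mem_univ _)
    exact (CStarRing.star_mul_self_eq_zero_iff _).mp h5
  obtain ⟨C, hC⟩ := hC hD
  exact ⟨C, fun j k => (congrFun (congrFun hC j) k).trans
    (CStarMatrix.mul_apply (M := star C) (N := C))⟩

theorem IsPosKernel.map {B A J : Type*} [CStarAlgebra B] [PartialOrder B] [StarOrderedRing B]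
    [CStarAlgebra A] [PartialOrder A] [StarOrderedRing A] [Fintype J] {c : J → J → B}
    (h : IsPosKernel c) (f : B →⋆ₐ[ℂ] A) : IsPosKernel (fun j k => f (c j k)) := by
  refine ⟨fun j k => by rw [← map_star, h.1], fun a => ?_⟩
  obtain ⟨C, hC⟩ := h.exists_factor
  have : ∑ j, ∑ k, star (a j) * f (c j k) * a k
      = ∑ l, star (∑ j, f (C l j) * a j) * (∑ j, f (C l j) * a j) := by
    simp only [hC, map_sum, map_mul, map_star, star_sum, star_mul, Finset.sum_mul, Finset.mul_sum,
      mul_assoc]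
    rw [Finset.sum_comm, Finset.sum_comm_cycle]
  rw [this]
  exact Finset.sum_nonneg fun l _ => star_mul_self_nonneg _

end FreeProduct

/-- A conditional expectation of `A` onto the unital subalgebra `ι(B) ≅ B`: a positive
`B`-bimodule map that restricts to the identity on `B`. -/
structure ConditionalExpectation {B A : Type*} [CStarAlgebra B] [PartialOrder B]
    [CStarAlgebra A] [PartialOrder A] (ι : B →⋆ₐ[ℂ] A) extends A →ₚ[ℂ] B where
  map_incl : ∀ b : B, toPositiveLinearMap (ι b) = b
  map_incl_mul : ∀ (b : B) (a : A), toPositiveLinearMap (ι b * a) = b * toPositiveLinearMap a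
  map_mul_incl : ∀ (a : A) (b : B), toPositiveLinearMap (a * ι b) = toPositiveLinearMap a * b

namespace ConditionalExpectation

variable {B A : Type*} [CStarAlgebra B] [PartialOrder B] [StarOrderedRing B]
  [CStarAlgebra A] [PartialOrder A] [StarOrderedRing A] {ι : B →⋆ₐ[ℂ] A}

noncomputable instance : CoeFun (ConditionalExpectation ι) (fun _ => A → B) := ⟨fun E => ⇑E.toPositiveLinearMap⟩

/-- `E` is faithful: `E(a* a) = 0` only for `a = 0`. -/
def IsFaithful (E : ConditionalExpectation ι) : Prop :=
  ∀ a : A, E (star a * a) = 0 → a = 0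

/-- `E` is normal: it preserves suprema of upwards directed sets. -/
def IsNormal (E : ConditionalExpectation ι) : Prop :=
  ∀ s : Set A, s.Nonempty → DirectedOn (· ≤ ·) s → ∀ a : A, IsLUB s a →
    IsLUB ((fun x => E x) '' s) (E a)

/-- The space of mean zero elements `(1 - E)(A) = ker E`. -/
noncomputable def meanZero (E : ConditionalExpectation ι) : Submodule ℂ A := LinearMap.ker (E.toPositiveLinearMap : A →ₗ[ℂ] B)

variable (E : ConditionalExpectation ι)

theorem mem_meanZero {a : A} : a ∈ E.meanZero ↔ E a = 0 := LinearMap.mem_ker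

theorem map_one' : E 1 = 1 := by simpa using E.map_incl 1

/-- The centering `a ↦ a - E(a)`. -/
noncomputable def center (a : A) : E.meanZero := ⟨a - ι (E a), by
  rw [mem_meanZero, map_sub, E.map_incl, sub_self]⟩

theorem center_inner (a c : A) :
    E (star (a - ι (E a)) * (c - ι (E c))) = E (star a * c) - star (E a) * E c := by
  have h : ∀ b, star (ι b) = ι (star b) := fun b => (map_star ι b).symm
  have h' : E (star a) = star (E a) := map_star E.toPositiveLinearMap a
  simp only [star_sub, sub_mul, mul_sub, map_sub, h, E.map_incl_mul, E.map_mul_incl, E.map_incl, h']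
  simp

end ConditionalExpectation

namespace FreeProduct

open ConditionalExpectation

variable {B : Type*} [CStarAlgebra B] [PartialOrder B] [StarOrderedRing B]
  {I : Type*} {A : I → Type*} [∀ i, CStarAlgebra (A i)] [∀ i, PartialOrder (A i)]
  [∀ i, StarOrderedRing (A i)] {ι : ∀ i, B →⋆ₐ[ℂ] A i} (E : ∀ i, ConditionalExpectation (ι i))

/-- A letter: an index `i` with a mean zero element of `A i`. -/
abbrev Letter : Type _ := Σ i, (E i).meanZero

/-- A list `[a₁, …, aₙ]` of letters stands for the elementary tensor `a₁ ⊗ ⋯ ⊗ aₙ`; it is reduced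
if neighbouring indices differ. -/
def Reduced (w : List (Letter E)) : Prop := w.IsChain (fun x y => x.1 ≠ y.1)

/-- Reduced words; the empty word stands for the unit of the summand `B`. -/
abbrev Word : Type _ := {w : List (Letter E) // Reduced E w}

open Classical in
/-- `gram c w v = ⟨w, c v⟩`, the `B`-valued inner product of elementary tensors with `c : B`
inserted: `⟨a ⊗ w, c (a' ⊗ v)⟩ = ⟨w, E(a* c a') v⟩`, and tensors of different type are orthogonal. -/
noncomputable def gram : B → List (Letter E) → List (Letter E) → B
  | c, [], [] => c
  | c, ⟨i, x⟩ :: w, ⟨j, y⟩ :: v =>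
    if h : i = j then gram (E j (star (h ▸ x : (E j).meanZero).1 * ι j c * y.1)) w v else 0
  | _, [], _ :: _ => 0
  | _, _ :: _, [] => 0

theorem gram_cons_self (c : B) (i : I) (x y : (E i).meanZero) (w v : List (Letter E)) :
    gram E c (⟨i, x⟩ :: w) (⟨i, y⟩ :: v) = gram E (E i (star x.1 * ι i c * y.1)) w v := by
  rw [gram, dif_pos rfl]

theorem gram_cons_ne (c : B) {x y : Letter E} (h : x.1 ≠ y.1) (w v : List (Letter E)) :
    gram E c (x :: w) (y :: v) = 0 := by
  rw [gram, dif_neg h]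

/-- The first letter of a word if it belongs to `A i`, and `1` otherwise. -/
noncomputable def first (i : I) : List (Letter E) → A i
  | [] => 1
  | ⟨j, x⟩ :: _ => open Classical in if h : j = i then (h ▸ x : (E i).meanZero).1 else 1

/-- What remains of a word when a first letter from `A i`, if there is one, is removed. -/
noncomputable def rest (i : I) : List (Letter E) → List (Letter E)
  | [] => []
  | x :: w => open Classical in if x.1 = i then w else x :: w

theorem first_rest_cases (i : I) (w : List (Letter E)) :
    (∃ x v, w = ⟨i, x⟩ :: v ∧ first E i w = x.1 ∧ rest E i w = v) ∨
      ((∀ x ∈ w.head?, x.1 ≠ i) ∧ first E i w = 1 ∧ rest E i w = w) := by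
  rcases w with _ | ⟨⟨j, x⟩, w⟩
  · right; simp [first, rest]
  · by_cases h : j = i
    · subst h; left; exact ⟨x, w, rfl, by simp [first], by simp [rest]⟩
    · right; simp [first, rest, h]

theorem rest_head (i : I) {w : List (Letter E)} (hw : Reduced E w) :
    ∀ x ∈ (rest E i w).head?, x.1 ≠ i := by
  rcases first_rest_cases E i w with ⟨x, v, rfl, -, h⟩ | ⟨h, -, h'⟩
  · rw [h]
    intro y hy
    exact (List.isChain_cons.mp hw).1 y hy |>.symm
  · rwa [h']

theorem rest_reduced (i : I) {w : List (Letter E)} (hw : Reduced E w) :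
    Reduced E (rest E i w) := by
  rcases first_rest_cases E i w with ⟨x, v, rfl, -, h⟩ | ⟨h, -, h'⟩
  · rw [h]; exact (List.isChain_cons.mp hw).2
  · rwa [h']

/-- Left multiplication of an elementary tensor by `c : B`, for tensors of positive length. -/
noncomputable def scaleWord (c : B) : List (Letter E) → List (Letter E)
  | [] => []
  | ⟨j, x⟩ :: v => ⟨j, ⟨ι j c * x.1, by
      have hx := x.2
      rw [mem_meanZero] at hx ⊢
      rw [(E j).map_incl_mul, hx, mul_zero]⟩⟩ :: v

theorem scaleWord_reduced (c : B) {w : List (Letter E)} (hw : Reduced E w) :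
    Reduced E (scaleWord E c w) := by
  rcases w with _ | ⟨⟨j, x⟩, w⟩
  · exact hw
  · exact List.isChain_cons.mpr (List.isChain_cons.mp hw)

theorem scaleWord_head (c : B) (i : I) {w : List (Letter E)} (hw : ∀ x ∈ w.head?, x.1 ≠ i) :
    ∀ x ∈ (scaleWord E c w).head?, x.1 ≠ i := by
  rcases w with _ | ⟨⟨j, x⟩, w⟩
  · exact hw
  · simpa [scaleWord] using hw

/-- Left multiplication of a tensor by `c : B`, for tensors of length zero. -/
noncomputable def scaleCoeff (c : B) : List (Letter E) → B →ₗ[ℂ] B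
  | [] => LinearMap.mulLeft ℂ c
  | _ :: _ => LinearMap.id

/-- The algebraic Fock space: finite sums of terms `w b`, with `w` a reduced elementary tensor and
`b : B` acting on the right. (The relations of the tensor products over `B` hold modulo vectors of
length zero, which disappear in the completion.) -/
def AlgFock : Type _ := Word E →₀ B

noncomputable instance : AddCommGroup (AlgFock E) := inferInstanceAs (AddCommGroup (Word E →₀ B))

noncomputable instance : Module ℂ (AlgFock E) := inferInstanceAs (Module ℂ (Word E →₀ B))

/-- The elementary vector `w b`. -/
noncomputable def vec (w : Word E) : B →ₗ[ℂ] AlgFock E := Finsupp.lsingle w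

/-- The sesquilinear form with `⟨w b, v b'⟩ = b* K(w,v) b'`. -/
noncomputable def form (K : Word E → Word E → B) (ξ η : AlgFock E) : B :=
  Finsupp.sum ξ fun w b => Finsupp.sum η fun v b' => star b * K w v * b'

/-- Left creation and multiplication: the action of `a : A i` on the algebraic Fock space. If `w`
is `h ⊗ w'` with `h` in `A i` (or `w = w'` does not start in `A i`, and `h = 1`), then `w` is mapped
to `(a h - E(a h)) ⊗ w' + E(a h) w'`. -/
noncomputable def preRep (i : I) (a : A i) : AlgFock E →ₗ[ℂ] AlgFock E :=
  Finsupp.lsum ℂ fun w : Word E =>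
    vec E ⟨⟨i, (E i).center (a * first E i w.1)⟩ :: rest E i w.1,
        List.isChain_cons.mpr ⟨fun y hy => (rest_head E i w.2 y hy).symm, rest_reduced E i w.2⟩⟩ +
      (vec E ⟨scaleWord E (E i (a * first E i w.1)) (rest E i w.1),
        scaleWord_reduced E _ (rest_reduced E i w.2)⟩).comp
          (scaleCoeff E (E i (a * first E i w.1)) (rest E i w.1))

/-! ### Positivity -/

theorem gram_zero (w v : List (Letter E)) : gram E 0 w v = 0 := by
  induction w generalizing v with
  | nil => cases v <;> simp [gram]
  | cons x w ih =>
    rcases v with _ | ⟨y, v⟩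
    · simp [gram]
    · by_cases h : x.1 = y.1
      · obtain ⟨i, x⟩ := x; obtain ⟨j, y⟩ := y
        obtain rfl : i = j := h
        rw [gram_cons_self]; simp only [map_zero, mul_zero, zero_mul, map_zero, ih]
      · exact gram_cons_ne E _ h _ _

theorem gram_add (c d : B) (w v : List (Letter E)) :
    gram E (c + d) w v = gram E c w v + gram E d w v := by
  induction w generalizing v c d with
  | nil => cases v <;> simp [gram]
  | cons x w ih =>
    rcases v with _ | ⟨y, v⟩
    · simp [gram]
    · by_cases h : x.1 = y.1
      · obtain ⟨i, x⟩ := x; obtain ⟨j, y⟩ := y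
        obtain rfl : i = j := h
        simp only [gram_cons_self, map_add, mul_add, add_mul, map_add, ih]
      · simp [gram_cons_ne E _ h]

theorem gram_star (c : B) (w v : List (Letter E)) :
    star (gram E c w v) = gram E (star c) v w := by
  induction w generalizing v c with
  | nil => cases v <;> simp [gram]
  | cons x w ih =>
    rcases v with _ | ⟨y, v⟩
    · simp [gram]
    · by_cases h : x.1 = y.1
      · obtain ⟨i, x⟩ := x; obtain ⟨j, y⟩ := y
        obtain rfl : i = j := h
        rw [gram_cons_self, gram_cons_self, ih, ← map_star]
        simp [mul_assoc, map_star]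
      · simp [gram_cons_ne E _ h, gram_cons_ne E _ (Ne.symm h)]

/-- The first letter of a word if it belongs to `A i`, and `0` otherwise. -/
noncomputable def head (i : I) : List (Letter E) → A i
  | [] => 0
  | ⟨j, x⟩ :: _ => open Classical in if h : j = i then (h ▸ x : (E i).meanZero).1 else 0

open Classical in
theorem gram_step (c : B) (w v : List (Letter E)) (S : Finset I) (hS : ∀ x ∈ w.head?, x.1 ∈ S) :
    gram E c w v = gram E ((if w = [] then 1 else 0) * c * (if v = [] then 1 else 0) +
      ∑ i ∈ S, E i (star (head E i w) * ι i c * head E i v)) w.tail v.tail := by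
  rcases w with _ | ⟨⟨i, x⟩, w⟩
  · rcases v with _ | ⟨⟨j, y⟩, v⟩
    · simp [gram, head, map_zero]
    · simp [gram, head, map_zero, gram_zero]
  · rcases v with _ | ⟨⟨j, y⟩, v⟩
    · simp [gram, head, map_zero, gram_zero]
    · rw [Finset.sum_eq_single i]
      · by_cases h : i = j
        · subst h; rw [gram_cons_self]; simp [head]
        · rw [gram_cons_ne E c h]
          simp [head, Ne.symm h, map_zero, gram_zero]
      · intro k _ hk
        simp [head, Ne.symm hk, map_zero]
      · intro h; exact absurd (hS ⟨i, x⟩ (by simp)) h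

theorem isPosKernel_gram_aux {J : Type*} [Fintype J] (N : ℕ) (w : J → List (Letter E))
    (hw : ∀ j, (w j).length ≤ N) (c : J → J → B) (hc : IsPosKernel c) :
    IsPosKernel fun j k => gram E (c j k) (w j) (w k) := by
  classical
  induction N generalizing w c with
  | zero =>
    have h : ∀ j, w j = [] := fun j => List.length_eq_zero_iff.mp (Nat.le_zero.mp (hw j))
    simpa [h, gram] using hc
  | succ N ih =>
    let S : Finset I := Finset.univ.biUnion fun j => ((w j).head?.map Sigma.fst).toFinset
    have hS : ∀ j, ∀ x ∈ (w j).head?, x.1 ∈ S := by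
      intro j x hx
      simp only [S, Finset.mem_biUnion, Finset.mem_univ, true_and, Option.mem_toFinset]
      exact ⟨j, by simp only [Option.mem_def] at hx ⊢; rw [hx]; rfl⟩
    simp_rw [fun j k => gram_step E (c j k) (w j) (w k) S (hS j)]
    refine ih (fun j => (w j).tail) (fun j => by have := hw j; simp; omega) _
      ⟨fun j k => ?_, fun b => ?_⟩
    · simp only [star_add, star_mul, star_sum, ← map_star, star_star, ← map_star, hc.1, mul_assoc]
      congr 2
      · split_ifs <;> simp
      · congr 1; split_ifs <;> simp
    · have key : ∑ j, ∑ k, star (b j) * ((if w j = [] then 1 else 0) * c j k *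
          (if w k = [] then 1 else 0) +
          ∑ i ∈ S, E i (star (head E i (w j)) * ι i (c j k) * head E i (w k))) * b k =
          (∑ j, ∑ k, star ((if w j = [] then 1 else 0) * b j) * c j k *
            ((if w k = [] then 1 else 0) * b k)) +
          ∑ i ∈ S, E i (∑ j, ∑ k, star (head E i (w j) * ι i (b j)) * ι i (c j k) *
            (head E i (w k) * ι i (b k))) := by
        simp only [map_sum]
        have h1 : ∀ i j k, E i (star (head E i (w j) * ι i (b j)) * ι i (c j k) *
            (head E i (w k) * ι i (b k))) =
            star (b j) * E i (star (head E i (w j)) * ι i (c j k) * head E i (w k)) * b k := by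
          intro i j k
          rw [← (E i).map_incl_mul, ← (E i).map_mul_incl]
          simp [mul_assoc, map_star]
        simp only [h1]
        rw [Finset.sum_comm (s := S), ← Finset.sum_add_distrib]
        refine Finset.sum_congr rfl fun j _ => ?_
        rw [Finset.sum_comm (s := S), ← Finset.sum_add_distrib]
        refine Finset.sum_congr rfl fun k _ => ?_
        rw [mul_add, add_mul, Finset.mul_sum, Finset.sum_mul]
        congr 1
        split_ifs <;> simp
      rw [key]
      exact add_nonneg (hc.2 _) (Finset.sum_nonneg fun i _ =>
        map_nonneg (E i).toPositiveLinearMap ((hc.map (ι i)).2 _))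

theorem isPosKernel_one {J : Type*} [Fintype J] : IsPosKernel fun _ _ : J => (1 : B) := by
  refine ⟨fun _ _ => star_one _, fun b => ?_⟩
  have : ∑ j, ∑ k, star (b j) * 1 * b k = star (∑ j, b j) * ∑ j, b j := by
    simp only [mul_one, Finset.sum_mul, Finset.mul_sum, star_sum]
    exact Finset.sum_comm
  rw [this]; exact star_mul_self_nonneg _

theorem isPosKernel_gram {J : Type*} [Fintype J] (w : J → List (Letter E)) :
    IsPosKernel fun j k => gram E 1 (w j) (w k) :=
  isPosKernel_gram_aux E (Finset.univ.sup fun j => (w j).length) w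
    (fun j => Finset.le_sup (f := fun j => (w j).length) (Finset.mem_univ j)) _ isPosKernel_one

/-! ### The form and the action -/

theorem alg_induction {p : AlgFock E → Prop} (h0 : p 0) (hadd : ∀ ξ η, p ξ → p η → p (ξ + η))
    (hvec : ∀ w b, p (vec E w b)) (ξ : AlgFock E) : p ξ :=
  Finsupp.induction_linear (motive := p) ξ h0 hadd hvec

theorem finsupp_sum_add_left {α : Type*} (K : α → α → B) (f f' g : α →₀ B) :
    ((f + f').sum fun w b => g.sum fun v b' => star b * K w v * b') =
      (f.sum fun w b => g.sum fun v b' => star b * K w v * b') +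
        f'.sum fun w b => g.sum fun v b' => star b * K w v * b' := by
  classical
  refine Finsupp.sum_add_index' (fun w => by simp [Finsupp.sum]) fun w b b' => ?_
  rw [← Finsupp.sum_add]
  simp only [star_add, add_mul]

theorem finsupp_sum_add_right {α : Type*} (K : α → α → B) (f g g' : α →₀ B) :
    (f.sum fun w b => (g + g').sum fun v b' => star b * K w v * b') =
      (f.sum fun w b => g.sum fun v b' => star b * K w v * b') +
        f.sum fun w b => g'.sum fun v b' => star b * K w v * b' := by
  classical
  rw [← Finsupp.sum_add]
  refine Finsupp.sum_congr fun w _ => ?_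
  exact Finsupp.sum_add_index' (by simp) (fun v b b' => by rw [mul_add])

theorem finsupp_sum_single {α : Type*} (K : α → α → B) (w v : α) (b c : B) :
    ((Finsupp.single w b).sum fun w b => (Finsupp.single v c).sum fun v b' =>
      star b * K w v * b') = star b * K w v * c := by
  rw [Finsupp.sum_single_index, Finsupp.sum_single_index] <;> simp [Finsupp.sum]

theorem form_vec (K : Word E → Word E → B) (w v : Word E) (b c : B) :
    form E K (vec E w b) (vec E v c) = star b * K w v * c := finsupp_sum_single K w v b c

theorem form_add_left (K : Word E → Word E → B) (ξ ξ' η : AlgFock E) :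
    form E K (ξ + ξ') η = form E K ξ η + form E K ξ' η := finsupp_sum_add_left K ξ ξ' η

theorem form_add_right (K : Word E → Word E → B) (ξ η η' : AlgFock E) :
    form E K ξ (η + η') = form E K ξ η + form E K ξ η' := finsupp_sum_add_right K ξ η η'

/-- Two functions that are biadditive agree if they agree on elementary vectors. -/
theorem eq_of_vec {f g : AlgFock E → AlgFock E → B}
    (hf : ∀ ξ ξ' η, f (ξ + ξ') η = f ξ η + f ξ' η) (hf' : ∀ ξ η η', f ξ (η + η') = f ξ η + f ξ η')
    (hg : ∀ ξ ξ' η, g (ξ + ξ') η = g ξ η + g ξ' η) (hg' : ∀ ξ η η', g ξ (η + η') = g ξ η + g ξ η')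
    (h : ∀ w v b c, f (vec E w b) (vec E v c) = g (vec E w b) (vec E v c)) (ξ η : AlgFock E) :
    f ξ η = g ξ η := by
  induction ξ using alg_induction with
  | h0 =>
    have h1 := hf 0 0 η
    have h2 := hg 0 0 η
    simp only [add_zero, left_eq_add] at h1 h2
    rw [h1, h2]
  | hadd ξ ξ' h1 h2 => rw [hf, hg, h1, h2]
  | hvec w b =>
    induction η using alg_induction with
    | h0 =>
      have h1 := hf' (vec E w b) 0 0
      have h2 := hg' (vec E w b) 0 0
      simp only [add_zero, left_eq_add] at h1 h2
      rw [h1, h2]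
    | hadd η η' h1 h2 => rw [hf', hg', h1, h2]
    | hvec v c => exact h w v b c

/-- The `B`-valued semi-inner product on the algebraic Fock space. -/
noncomputable instance : Inner B (AlgFock E) := ⟨form E fun w v => gram E 1 w.1 v.1⟩

theorem inner_vec (w v : Word E) (b c : B) :
    inner B (vec E w b) (vec E v c) = star b * gram E 1 w.1 v.1 * c := form_vec E _ w v b c

theorem inner_add_left (ξ ξ' η : AlgFock E) :
    inner B (ξ + ξ') η = inner B ξ η + inner B ξ' η := form_add_left E _ ξ ξ' η

theorem inner_add_right (ξ η η' : AlgFock E) :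
    inner B ξ (η + η') = inner B ξ η + inner B ξ η' := form_add_right E _ ξ η η'

theorem star_inner (ξ η : AlgFock E) : star (inner B ξ η) = inner B η ξ := by
  refine eq_of_vec E (f := fun ξ η => star (inner B ξ η)) (g := fun ξ η => inner B η ξ)
    ?_ ?_ ?_ ?_ ?_ ξ η
  · intros; simp only [inner_add_left, star_add]
  · intros; simp only [inner_add_right, star_add]
  · intros; simp only [inner_add_right]
  · intros; simp only [inner_add_left]
  · intro w v b c
    simp only [inner_vec, star_mul, star_star, gram_star, star_one, mul_assoc]

/-- The right action of `B`. -/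
noncomputable def rightMul (b : B) : AlgFock E →ₗ[ℂ] AlgFock E :=
  Finsupp.mapRange.linearMap (LinearMap.mulRight ℂ b)

theorem rightMul_vec (b c : B) (w : Word E) : rightMul E b (vec E w c) = vec E w (c * b) :=
  Finsupp.mapRange_single (hf := map_zero (LinearMap.mulRight ℂ b))

theorem inner_rightMul_right (ξ η : AlgFock E) (b : B) :
    inner B ξ (rightMul E b η) = inner B ξ η * b := by
  refine eq_of_vec E (f := fun ξ η => inner B ξ (rightMul E b η)) (g := fun ξ η => inner B ξ η * b)
    ?_ ?_ ?_ ?_ ?_ ξ η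
  · intros; simp only [inner_add_left]
  · intros; simp only [map_add, inner_add_right]
  · intros; simp only [inner_add_left, add_mul]
  · intros; simp only [inner_add_right, add_mul]
  · intro w v c d
    simp only [rightMul_vec, inner_vec, mul_assoc]

theorem smul_eq_rightMul (z : ℂ) (ξ : AlgFock E) : z • ξ = rightMul E (z • 1) ξ := by
  induction ξ using alg_induction with
  | h0 => simp
  | hadd ξ ξ' h1 h2 => rw [smul_add, map_add, h1, h2]
  | hvec w b => rw [rightMul_vec, ← map_smul, mul_smul_comm, mul_one]

theorem inner_rightMul_left (ξ η : AlgFock E) (b : B) :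
    inner B (rightMul E b ξ) η = star b * inner B ξ η := by
  rw [← star_inner, inner_rightMul_right, star_mul, star_inner]

theorem inner_smul_right (ξ η : AlgFock E) (z : ℂ) : inner B ξ (z • η) = z • inner B ξ η := by
  rw [smul_eq_rightMul, inner_rightMul_right, mul_smul_comm, mul_one]

theorem inner_smul_left (ξ η : AlgFock E) (z : ℂ) : inner B (z • ξ) η = star z • inner B ξ η := by
  rw [← star_inner, inner_smul_right, star_smul, star_inner]

theorem inner_sub_right (ξ η η' : AlgFock E) :
    inner B ξ (η - η') = inner B ξ η - inner B ξ η' := by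
  rw [eq_sub_iff_add_eq, ← inner_add_right, sub_add_cancel]

theorem inner_sub_left (ξ ξ' η : AlgFock E) :
    inner B (ξ - ξ') η = inner B ξ η - inner B ξ' η := by
  rw [eq_sub_iff_add_eq, ← inner_add_left, sub_add_cancel]

theorem inner_self_nonneg (ξ : AlgFock E) : 0 ≤ inner B ξ ξ := by
  let ξ' : Word E →₀ B := ξ
  have h := (isPosKernel_gram E fun j : ξ'.support => j.1.1).2 fun j => ξ' j.1
  have : inner B ξ ξ = ∑ j : ξ'.support, ∑ k : ξ'.support,
      star (ξ' j.1) * gram E 1 j.1.1 k.1.1 * ξ' k.1 := by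
    rw [Finset.sum_coe_sort ξ'.support fun j => ∑ k : ξ'.support,
      star (ξ' j) * gram E 1 j.1 k.1.1 * ξ' k.1]
    refine Finset.sum_congr rfl fun j _ => ?_
    rw [Finset.sum_coe_sort ξ'.support fun k => star (ξ' j) * gram E 1 j.1 k.1 * ξ' k]
    rfl
  rw [this]; exact h

theorem norm_inner_sq_le (ξ η : AlgFock E) :
    ‖inner B ξ η‖ ^ 2 ≤ ‖inner B ξ ξ‖ * ‖inner B η η‖ := by
  have key : ∀ c : ℝ, 0 < c → ‖inner B ξ ξ‖ ≤ c → ‖inner B ξ η‖ ^ 2 ≤ c * ‖inner B η η‖ := by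
    intro c hc hle
    set b := inner B ξ η with hb
    have h1 : star b * inner B ξ ξ * b ≤ (c : ℂ) • (star b * b) := by
      refine (CStarAlgebra.star_left_conjugate_le_norm_smul
        (IsSelfAdjoint.of_nonneg (inner_self_nonneg E ξ))).trans ?_
      rw [Complex.coe_smul]
      exact smul_le_smul_of_nonneg_right hle (star_mul_self_nonneg b)
    have h0 := inner_self_nonneg E (rightMul E b ξ - (c : ℂ) • η)
    have e : inner B (rightMul E b ξ - (c : ℂ) • η) (rightMul E b ξ - (c : ℂ) • η) =
        star b * inner B ξ ξ * b - (c : ℂ) • (star b * b) - (c : ℂ) • (star b * b)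
          + (c : ℂ) • (c : ℂ) • inner B η η := by
      have hb' : inner B η ξ = star b := by rw [hb, star_inner]
      simp only [inner_sub_left, inner_sub_right, inner_rightMul_left, inner_rightMul_right,
        inner_smul_left, inner_smul_right, hb', ← hb]
      simp only [Complex.star_def, Complex.conj_ofReal, smul_mul_assoc, smul_sub,
        sub_mul, mul_assoc]
      abel
    rw [e] at h0
    have h2 : (c : ℂ) • (star b * b) ≤ (c : ℂ) • (c : ℂ) • inner B η η := by
      have : 0 ≤ (c : ℂ) • (c : ℂ) • inner B η η - (c : ℂ) • (star b * b) := by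
        refine h0.trans ?_
        rw [← sub_nonneg] at h1 ⊢
        convert h1 using 1
        abel
      exact sub_nonneg.mp this
    have h3 : star b * b ≤ (c : ℂ) • inner B η η := by
      rw [Complex.coe_smul, Complex.coe_smul] at h2
      rw [Complex.coe_smul]
      exact (smul_le_smul_iff_of_pos_left hc).mp h2
    have h4 := CStarAlgebra.norm_le_norm_of_nonneg_of_le (star_mul_self_nonneg b) h3
    rw [CStarRing.norm_star_mul_self, norm_smul] at h4
    simpa [sq, abs_of_pos hc] using h4
  refine le_of_forall_pos_le_add fun ε hε => ?_
  have hδ : 0 < ε / (‖inner B η η‖ + 1) := by positivity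
  refine (key (‖inner B ξ ξ‖ + ε / (‖inner B η η‖ + 1)) (by positivity) (by linarith)).trans ?_
  rw [add_mul]
  gcongr
  rw [div_mul_eq_mul_div, div_le_iff₀ (by positivity)]
  nlinarith [norm_nonneg (inner B η η)]

/-- The seminorm `‖ξ‖ = ‖⟨ξ, ξ⟩‖^{1/2}`. -/
noncomputable instance : Norm (AlgFock E) := ⟨fun ξ => √‖inner B ξ ξ‖⟩

theorem norm_sq_eq (ξ : AlgFock E) : ‖ξ‖ ^ 2 = ‖inner B ξ ξ‖ := Real.sq_sqrt (norm_nonneg _)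

theorem norm_inner_le (ξ η : AlgFock E) : ‖inner B ξ η‖ ≤ ‖ξ‖ * ‖η‖ := by
  refine Real.le_sqrt_of_sq_le (norm_inner_sq_le E ξ η) |>.trans ?_
  exact (Real.sqrt_mul (norm_nonneg _) _).le

theorem seminormCore : SeminormedSpace.Core ℂ (AlgFock E) where
  norm_nonneg _ := Real.sqrt_nonneg _
  norm_smul z ξ := by
    change √‖inner B (z • ξ) (z • ξ)‖ = ‖z‖ * √‖inner B ξ ξ‖
    rw [inner_smul_left, inner_smul_right, norm_smul, norm_smul, norm_star, ← mul_assoc,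
      Real.sqrt_mul (by positivity), Real.sqrt_mul_self (norm_nonneg _)]
  norm_triangle ξ η := by
    have h0 : ∀ ζ : AlgFock E, 0 ≤ ‖ζ‖ := fun _ => Real.sqrt_nonneg _
    refine le_of_sq_le_sq ?_ (add_nonneg (h0 ξ) (h0 η))
    rw [norm_sq_eq, inner_add_left, inner_add_right, inner_add_right]
    calc _ ≤ ‖inner B ξ ξ‖ + ‖inner B ξ η‖ + (‖inner B η ξ‖ + ‖inner B η η‖) :=
          (norm_add_le _ _).trans (add_le_add (norm_add_le _ _) (norm_add_le _ _))
      _ ≤ ‖ξ‖ ^ 2 + ‖ξ‖ * ‖η‖ + (‖η‖ * ‖ξ‖ + ‖η‖ ^ 2) := by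
          rw [norm_sq_eq, norm_sq_eq]
          gcongr <;> exact norm_inner_le E _ _
      _ = (‖ξ‖ + ‖η‖) ^ 2 := by ring

noncomputable instance : SeminormedAddCommGroup (AlgFock E) :=
  SeminormedAddCommGroup.ofCore (seminormCore E)

noncomputable instance : NormedSpace ℂ (AlgFock E) where
  norm_smul_le z ξ := ((seminormCore E).norm_smul z ξ).le

theorem gram_smul (z : ℂ) (c : B) (w v : List (Letter E)) :
    gram E (z • c) w v = z • gram E c w v := by
  induction w generalizing v c with
  | nil => cases v <;> simp [gram]
  | cons x w ih =>
    rcases v with _ | ⟨y, v⟩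
    · simp [gram]
    · by_cases h : x.1 = y.1
      · obtain ⟨i, x⟩ := x; obtain ⟨j, y⟩ := y
        obtain rfl : i = j := h
        simp only [gram_cons_self, map_smul, mul_smul_comm, smul_mul_assoc, ih]
      · simp [gram_cons_ne E _ h]

/-- The kernel of the form `⟨w, π_i(a) v⟩`. -/
noncomputable def kernel (i : I) (a : A i) (w v : Word E) : B :=
  gram E (E i (star (first E i w.1) * a * first E i v.1)) (rest E i w.1) (rest E i v.1)

theorem gram_scaleWord_right (c d : B) (w v : List (Letter E)) (b : B) :
    gram E c w (scaleWord E d v) * scaleCoeff E d v b = gram E (c * d) w v * b := by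
  rcases w with _ | ⟨⟨i, x⟩, w⟩ <;> rcases v with _ | ⟨⟨j, y⟩, v⟩
  · simp [scaleWord, scaleCoeff, gram, mul_assoc]
  · simp [scaleWord, gram]
  · simp [scaleWord, gram]
  · by_cases h : i = j
    · subst h
      simp [scaleWord, scaleCoeff, gram_cons_self, mul_assoc]
    · simp [scaleWord, gram_cons_ne, h]

theorem gram_scaleWord_left (c d : B) (w v : List (Letter E)) (b : B) :
    star (scaleCoeff E d w b) * gram E c (scaleWord E d w) v = star b * gram E (star d * c) w v := by
  have := congrArg star (gram_scaleWord_right E (star c) d v w b)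
  simpa [gram_star] using this

theorem gram_cons_of_head (c : B) (i : I) (x : (E i).meanZero) (w v : List (Letter E))
    (hv : ∀ y ∈ v.head?, y.1 ≠ i) : gram E c (⟨i, x⟩ :: w) v = 0 := by
  rcases v with _ | ⟨y, v⟩
  · simp [gram]
  · exact gram_cons_ne E c (hv y (by simp)).symm _ _

theorem gram_of_head_cons (c : B) (i : I) (x : (E i).meanZero) (w v : List (Letter E))
    (hv : ∀ y ∈ v.head?, y.1 ≠ i) : gram E c v (⟨i, x⟩ :: w) = 0 := by
  rw [← star_star (gram E c v _), gram_star, gram_cons_of_head E _ i x w v hv, star_zero]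

theorem preRep_vec (i : I) (a : A i) (w : Word E) (b : B) :
    preRep E i a (vec E w b) =
      vec E ⟨⟨i, (E i).center (a * first E i w.1)⟩ :: rest E i w.1,
        List.isChain_cons.mpr ⟨fun y hy => (rest_head E i w.2 y hy).symm, rest_reduced E i w.2⟩⟩ b +
      vec E ⟨scaleWord E (E i (a * first E i w.1)) (rest E i w.1),
        scaleWord_reduced E _ (rest_reduced E i w.2)⟩
          (scaleCoeff E (E i (a * first E i w.1)) (rest E i w.1) b) := by
  unfold preRep
  exact Finsupp.lsum_single ..

theorem inner_preRep (i : I) (a : A i) (ξ η : AlgFock E) :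
    inner B ξ (preRep E i a η) = form E (kernel E i a) ξ η := by
  refine eq_of_vec E (f := fun ξ η => inner B ξ (preRep E i a η)) ?_ ?_
    (form_add_left E _) (form_add_right E _) ?_ ξ η
  · intros; simp only [inner_add_left]
  · intros; simp only [map_add, inner_add_right]
  · intro w v b c
    simp only [preRep_vec, inner_add_right, inner_vec, form_vec, mul_assoc, gram_scaleWord_right,
      one_mul]
    rw [← mul_add, ← add_mul]
    congr 2
    unfold kernel
    rcases first_rest_cases E i w.1 with ⟨x, w', hw, h1, h2⟩ | ⟨hw, h1, h2⟩
    · have hw' : ∀ y ∈ w'.head?, y.1 ≠ i := h2 ▸ rest_head E i w.2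
      rw [hw, gram_cons_self, gram_cons_of_head E _ i x w' _ (rest_head E i v.2), add_zero, ← hw,
        h1, h2]
      congr 1
      simp only [center, map_one, mul_one, mul_sub, map_sub, (E i).map_mul_incl]
      have : E i (star x.1) = 0 := by
        rw [map_star, (mem_meanZero (E i)).mp x.2, star_zero]
      rw [this, zero_mul, sub_zero, mul_assoc]
    · rw [gram_of_head_cons E _ i _ _ _ hw, zero_add, h1, h2]
      simp

theorem inner_preRep_preRep (i : I) (a c : A i) (ξ η : AlgFock E) :
    inner B (preRep E i a ξ) (preRep E i c η) = form E (kernel E i (star a * c)) ξ η := by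
  refine eq_of_vec E (f := fun ξ η => inner B (preRep E i a ξ) (preRep E i c η)) ?_ ?_
    (form_add_left E _) (form_add_right E _) ?_ ξ η
  · intros; simp only [map_add, inner_add_left]
  · intros; simp only [map_add, inner_add_right]
  · intro w v b d
    simp only [preRep_vec, inner_add_right, inner_add_left, inner_vec, form_vec]
    rw [gram_cons_self, gram_cons_of_head E _ i _ _ _ (scaleWord_head E _ i (rest_head E i v.2)),
      gram_of_head_cons E _ i _ _ _ (scaleWord_head E _ i (rest_head E i w.2))]
    rw [gram_scaleWord_left, mul_assoc _ _ (scaleCoeff E _ _ d), mul_assoc (star b) _ (scaleCoeff E _ _ d),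
      gram_scaleWord_right]
    simp only [mul_zero, zero_mul, add_zero, zero_add, mul_one, ← mul_assoc, ← add_mul]
    rw [← mul_add, ← gram_add]
    unfold kernel
    congr 3
    simp only [center, map_one, mul_one]
    rw [center_inner]
    simp [mul_assoc]

theorem kernel_add (i : I) (a c : A i) (ξ η : AlgFock E) :
    form E (kernel E i (a + c)) ξ η = form E (kernel E i a) ξ η + form E (kernel E i c) ξ η := by
  refine eq_of_vec E (g := fun ξ η => form E (kernel E i a) ξ η + form E (kernel E i c) ξ η)
    (form_add_left E _) (form_add_right E _) ?_ ?_ ?_ ξ η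
  · intros; simp only [form_add_left]; abel
  · intros; simp only [form_add_right]; abel
  · intro w v b d
    simp only [form_vec, kernel, mul_add, add_mul, map_add, gram_add]

theorem kernel_smul (i : I) (z : ℂ) (a : A i) (ξ η : AlgFock E) :
    form E (kernel E i (z • a)) ξ η = z • form E (kernel E i a) ξ η := by
  refine eq_of_vec E (g := fun ξ η => z • form E (kernel E i a) ξ η)
    (form_add_left E _) (form_add_right E _) ?_ ?_ ?_ ξ η
  · intros; simp only [form_add_left, smul_add]
  · intros; simp only [form_add_right, smul_add]
  · intro w v b d
    simp only [form_vec, kernel, mul_smul_comm, smul_mul_assoc, map_smul, gram_smul]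

theorem kernel_one (i : I) (ξ η : AlgFock E) : form E (kernel E i 1) ξ η = inner B ξ η := by
  refine eq_of_vec E (form_add_left E _) (form_add_right E _) (inner_add_left E) (inner_add_right E)
    ?_ ξ η
  intro w v b d
  rw [form_vec, inner_vec]
  congr 2
  unfold kernel
  rcases first_rest_cases E i w.1 with ⟨x, w', hw, h1, h2⟩ | ⟨hw, h1, h2⟩ <;>
  rcases first_rest_cases E i v.1 with ⟨y, v', hv, h3, h4⟩ | ⟨hv, h3, h4⟩
  · rw [h1, h2, h3, h4, hw, hv, gram_cons_self, map_one]
  · rw [h1, h2, h3, h4, hw, gram_cons_of_head E _ i _ _ _ hv]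
    have : E i (star x.1) = 0 := by
      rw [map_star, (mem_meanZero (E i)).mp x.2, star_zero]
    simp [this, gram_zero]
  · rw [h1, h2, h3, h4, hv, gram_of_head_cons E _ i _ _ _ hw]
    simp [(mem_meanZero (E i)).mp y.2, gram_zero]
  · rw [h1, h2, h3, h4]; simp [map_one']

theorem kernel_star (i : I) (a : A i) (ξ η : AlgFock E) :
    star (form E (kernel E i a) ξ η) = form E (kernel E i (star a)) η ξ := by
  refine eq_of_vec E (f := fun ξ η => star (form E (kernel E i a) ξ η))
    (g := fun ξ η => form E (kernel E i (star a)) η ξ) ?_ ?_ ?_ ?_ ?_ ξ η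
  · intros; simp only [form_add_left, star_add]
  · intros; simp only [form_add_right, star_add]
  · intros; simp only [form_add_right]
  · intros; simp only [form_add_left]
  · intro w v b d
    simp only [form_vec, kernel, star_mul, gram_star, ← map_star, star_star, mul_assoc]

theorem norm_preRep_le (i : I) (a : A i) (ξ : AlgFock E) :
    ‖preRep E i a ξ‖ ≤ ‖a‖ * ‖ξ‖ := by
  have h1 : star a * a ≤ algebraMap ℝ (A i) (‖a‖ ^ 2) := by
    rw [sq, ← CStarRing.norm_star_mul_self]
    exact IsSelfAdjoint.le_algebraMap_norm_self (IsSelfAdjoint.star_mul_self a)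
  obtain ⟨d, hd⟩ := CStarAlgebra.nonneg_iff_eq_star_mul_self.mp (sub_nonneg.mpr h1)
  have h2 : inner B (preRep E i d ξ) (preRep E i d ξ) +
      inner B (preRep E i a ξ) (preRep E i a ξ) = ((‖a‖ ^ 2 : ℝ) : ℂ) • inner B ξ ξ := by
    rw [inner_preRep_preRep, inner_preRep_preRep, ← kernel_add, ← hd, sub_add_cancel,
      ← kernel_one E i, ← kernel_smul, Algebra.algebraMap_eq_smul_one, Complex.coe_smul]
  have h3 : inner B (preRep E i a ξ) (preRep E i a ξ) ≤ ((‖a‖ ^ 2 : ℝ) : ℂ) • inner B ξ ξ := by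
    rw [← h2]; exact le_add_of_nonneg_left (inner_self_nonneg E _)
  have h4 := CStarAlgebra.norm_le_norm_of_nonneg_of_le (inner_self_nonneg E _) h3
  rw [norm_smul, ← norm_sq_eq, ← norm_sq_eq, Complex.norm_real, norm_pow, norm_norm,
    ← mul_pow] at h4
  exact le_of_sq_le_sq h4 (by positivity)

/-! ### The Fock space and the free product representation -/

/-- The Fock space `B ⊕ ⨁ H_{i₁} ⊗_B ⋯ ⊗_B H_{iₙ}` over `i₁ ≠ ⋯ ≠ iₙ`: the (separated) completion
of the algebraic Fock space. Its `B`-valued inner product is the continuous extension. -/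
abbrev Fock : Type _ := UniformSpace.Completion (AlgFock E)

theorem continuous_inner_alg : Continuous fun p : AlgFock E × AlgFock E => inner B p.1 p.2 := by
  let f : AlgFock E →ₗ⋆[ℂ] AlgFock E →ₗ[ℂ] B := LinearMap.mk₂'ₛₗ (starRingEnd ℂ) (RingHom.id ℂ)
    (fun ξ η => inner B ξ η) (inner_add_left E) (fun z ξ η => inner_smul_left E ξ η z)
    (inner_add_right E) (fun z ξ η => inner_smul_right E ξ η z)
  let F : AlgFock E →L⋆[ℂ] AlgFock E →L[ℂ] B := f.mkContinuous₂ 1 fun ξ η => by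
    rw [one_mul]; exact norm_inner_le E ξ η
  exact (F.continuous.comp continuous_fst).clm_apply continuous_snd

theorem continuous_inner_fock : Continuous fun p : Fock E × Fock E => inner B p.1 p.2 := by
  let f : AlgFock E →+ AlgFock E →+ B :=
    AddMonoidHom.mk' (fun ξ => AddMonoidHom.mk' (fun η => inner B ξ η) (inner_add_right E ξ))
      fun ξ ξ' => by ext η; exact inner_add_left E ξ ξ' η
  have hf : Continuous fun p : AlgFock E × AlgFock E => f p.1 p.2 := continuous_inner_alg E
  exact (UniformSpace.Completion.isDenseInducing_toCompl (AlgFock E)).extend_Z_bilin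
    (UniformSpace.Completion.isDenseInducing_toCompl (AlgFock E)) hf

theorem continuous_inner_comp {X : Type*} [TopologicalSpace X] {f g : X → Fock E}
    (hf : Continuous f) (hg : Continuous g) : Continuous fun x => inner B (f x) (g x) :=
  (continuous_inner_fock E).comp (hf.prodMk hg)

theorem inner_coe (ξ η : AlgFock E) : inner B (ξ : Fock E) (η : Fock E) = inner B ξ η :=
  (UniformSpace.Completion.isDenseInducing_coe.prodMap
    UniformSpace.Completion.isDenseInducing_coe).extend_eq (continuous_inner_alg E) (ξ, η)

theorem norm_sq_fock (x : Fock E) : ‖x‖ ^ 2 = ‖inner B x x‖ := by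
  induction x using UniformSpace.Completion.induction_on with
  | hp => exact isClosed_eq (by fun_prop) (continuous_inner_comp E continuous_id continuous_id).norm
  | ih ξ => rw [inner_coe, UniformSpace.Completion.norm_coe, norm_sq_eq]

theorem fock_add_left (x y z : Fock E) : inner B (x + y) z = inner B x z + inner B y z := by
  induction x, y, z using UniformSpace.Completion.induction_on₃ with
  | hp =>
    exact isClosed_eq (continuous_inner_comp E (by fun_prop) (by fun_prop))
      ((continuous_inner_comp E (by fun_prop) (by fun_prop)).add
        (continuous_inner_comp E (by fun_prop) (by fun_prop)))
  | ih a b c => rw [← UniformSpace.Completion.coe_add]; simp only [inner_coe, inner_add_left]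

theorem fock_star_inner (x y : Fock E) : star (inner B x y) = inner B y x := by
  have hc := continuous_inner_fock E
  induction x, y using UniformSpace.Completion.induction_on₂ with
  | hp =>
    exact isClosed_eq (continuous_star.comp hc) (hc.comp continuous_swap)
  | ih a b => simp only [inner_coe, star_inner]

theorem fock_add_right (x y z : Fock E) : inner B x (y + z) = inner B x y + inner B x z := by
  rw [← fock_star_inner, fock_add_left, star_add, fock_star_inner, fock_star_inner]

theorem fock_smul_right (x y : Fock E) (z : ℂ) : inner B x (z • y) = z • inner B x y := by
  induction x, y using UniformSpace.Completion.induction_on₂ with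
  | hp =>
    exact isClosed_eq
      (continuous_inner_comp E continuous_fst ((continuous_const_smul z).comp continuous_snd))
      ((continuous_const_smul z).comp (continuous_inner_fock E))
  | ih a b => rw [← UniformSpace.Completion.coe_smul]; simp only [inner_coe, inner_smul_right]

theorem fock_smul_left (x y : Fock E) (z : ℂ) : inner B (z • x) y = star z • inner B x y := by
  rw [← fock_star_inner, fock_smul_right, star_smul, fock_star_inner]

/-- The algebra `L(H)` of adjointable operators on the Fock space, with the operator norm.
(An operator with an adjoint is automatically a right `B`-module map.) -/
noncomputable def adjointable : Subalgebra ℂ (Fock E →L[ℂ] Fock E) where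
  carrier := {T | ∃ S : Fock E → Fock E, ∀ x y, inner B (S x) y = inner B x (T y)}
  mul_mem' := by
    rintro T T' ⟨S, hS⟩ ⟨S', hS'⟩
    exact ⟨fun x => S' (S x), fun x y => by rw [hS', hS]; rfl⟩
  add_mem' := by
    rintro T T' ⟨S, hS⟩ ⟨S', hS'⟩
    exact ⟨fun x => S x + S' x, fun x y => by
      rw [fock_add_left, hS, hS', ← fock_add_right]; rfl⟩
  algebraMap_mem' z := ⟨fun x => star z • x, fun x y => by
    rw [fock_smul_left, star_star, ← fock_smul_right, Algebra.algebraMap_eq_smul_one]; rfl⟩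

/-- The bounded operator by which `a : A i` acts on the Fock space. -/
noncomputable def repCLM (i : I) (a : A i) : Fock E →L[ℂ] Fock E :=
  ((preRep E i a).mkContinuous ‖a‖ (norm_preRep_le E i a)).completion

theorem repCLM_coe (i : I) (a : A i) (ξ : AlgFock E) :
    repCLM E i a (ξ : Fock E) = (preRep E i a ξ : AlgFock E) :=
  ContinuousLinearMap.completion_apply_coe _ ξ

theorem inner_preRep_left (i : I) (a : A i) (ξ η : AlgFock E) :
    inner B (preRep E i (star a) ξ) η = inner B ξ (preRep E i a η) := by
  rw [inner_preRep, ← star_inner, inner_preRep, kernel_star, star_star]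

theorem repCLM_star (i : I) (a : A i) (x y : Fock E) :
    inner B (repCLM E i (star a) x) y = inner B x (repCLM E i a y) := by
  induction x, y using UniformSpace.Completion.induction_on₂ with
  | hp =>
    exact isClosed_eq
      (continuous_inner_comp E ((repCLM E i (star a)).continuous.comp continuous_fst) continuous_snd)
      (continuous_inner_comp E continuous_fst ((repCLM E i a).continuous.comp continuous_snd))
  | ih ξ η => rw [repCLM_coe, repCLM_coe, inner_coe, inner_coe, inner_preRep_left]

theorem coe_eq_coe {ξ η : AlgFock E} (h : ∀ ζ, inner B ζ ξ = inner B ζ η) :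
    (ξ : Fock E) = (η : Fock E) := by
  rw [← sub_eq_zero, ← UniformSpace.Completion.coe_sub, ← norm_eq_zero,
    UniformSpace.Completion.norm_coe, ← sq_eq_zero_iff, norm_sq_eq, inner_sub_right, h, sub_self,
    norm_zero]

theorem repCLM_ext {T S : Fock E →L[ℂ] Fock E} (h : ∀ ξ : AlgFock E, T ξ = S ξ) : T = S := by
  ext x
  induction x using UniformSpace.Completion.induction_on with
  | hp => exact isClosed_eq T.continuous S.continuous
  | ih ξ => exact h ξ

/-- The representation `π_i : A i → L(H)` of the reduced free product with amalgamation. It is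
a `*`-homomorphism by `repCLM_star`. -/
noncomputable def rep (i : I) : A i →ₐ[ℂ] adjointable E :=
  AlgHom.ofLinearMap
    { toFun := fun a => ⟨repCLM E i a, repCLM E i (star a), repCLM_star E i a⟩
      map_add' := fun a c => Subtype.ext <| repCLM_ext E fun ξ => by
        change repCLM E i (a + c) ξ = repCLM E i a ξ + repCLM E i c ξ
        rw [repCLM_coe, repCLM_coe, repCLM_coe, ← UniformSpace.Completion.coe_add]
        exact coe_eq_coe E fun ζ => by
          rw [inner_add_right, inner_preRep, inner_preRep, inner_preRep, kernel_add]
      map_smul' := fun z a => Subtype.ext <| repCLM_ext E fun ξ => by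
        change repCLM E i (z • a) ξ = z • repCLM E i a ξ
        rw [repCLM_coe, repCLM_coe, ← UniformSpace.Completion.coe_smul]
        exact coe_eq_coe E fun ζ => by
          rw [inner_smul_right, inner_preRep, inner_preRep, kernel_smul] }
    (Subtype.ext <| repCLM_ext E fun ξ => by
      change repCLM E i 1 ξ = ξ
      rw [repCLM_coe]
      exact coe_eq_coe E fun ζ => by rw [inner_preRep, kernel_one])
    (fun a c => Subtype.ext <| repCLM_ext E fun ξ => by
      change repCLM E i (a * c) ξ = repCLM E i a (repCLM E i c ξ)
      rw [repCLM_coe, repCLM_coe, repCLM_coe]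
      exact coe_eq_coe E fun ζ => by
        rw [← inner_preRep_left E i a, inner_preRep_preRep, inner_preRep, star_star])

end FreeProduct

namespace FreeProduct

open ConditionalExpectation

variable {B : Type*} [CStarAlgebra B] [PartialOrder B] [StarOrderedRing B]
  {I : Type*} {A : I → Type*} [∀ i, CStarAlgebra (A i)] [∀ i, PartialOrder (A i)]
  [∀ i, StarOrderedRing (A i)] {ι : ∀ i, B →⋆ₐ[ℂ] A i} (E : ∀ i, ConditionalExpectation (ι i))

/-! Let `P_i` be the projection onto the tensors that begin with a factor from `H_i`, and `Q_i = 1 -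
P_i`. Cutting `π_i(a_i)` by `P_i` and `Q_i` on both sides gives four blocks.

The block `Q_i π_i(a_i) Q_i` vanishes: on tensors that do not begin in `H_i`, the compression of
`π_i(a)` is left multiplication by `E_i(a)` (`form_kernel_tailProj`), and `E_i(a_i) = 0`. The other
three blocks, summed over `i`, give the three terms of the estimate.

Diagonal, `P_i π_i(a_i) P_i`: the `P_i` are mutually orthogonal, so the sum is a block diagonal
operator, bounded by the largest `‖a_i‖` (`norm_sum_diagonal_le`).

Creation, `P_i π_i(a_i) Q_i`: the images are again orthogonal, so the square of the sum at `ξ` is at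
most `∑ ⟨Q_i ξ, π_i(a_i* a_i) Q_i ξ⟩ = ∑ ⟨Q_i ξ, E_i(a_i* a_i) Q_i ξ⟩`. Since `Q_i` commutes with
left multiplication by `B`, it can be dropped here, which leaves `⟨ξ, (∑ E_i(a_i* a_i)) ξ⟩`
(`norm_sum_creation_le`). The estimates are added in the order of `B` and norms are taken only at
the end; this is why the norm of the sum appears and not a sum of norms.

Annihilation, `Q_i π_i(a_i) P_i`: the sum is the adjoint of the creation sum for the `a_i*`
(`norm_sum_annihilation_le`).

All this takes place on the algebraic Fock space, with forms in place of operators where the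
relations hold only modulo null vectors; density then gives the operator norm. -/

theorem form_zero_left (K : Word E → Word E → B) (ξ : AlgFock E) : form E K 0 ξ = 0 := by
  have h := form_add_left E K 0 0 ξ
  rwa [add_zero, left_eq_add] at h

theorem form_zero_right (K : Word E → Word E → B) (ξ : AlgFock E) : form E K ξ 0 = 0 := by
  have h := form_add_right E K ξ 0 0
  rwa [add_zero, left_eq_add] at h

/-! ### Left multiplication by `B`, as a family of forms -/

/-- `gramForm c ξ η = ⟨ξ, c η⟩`, where `c : B` acts by left multiplication. -/
noncomputable def gramForm (c : B) (ξ η : AlgFock E) : B :=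
  form E (fun w v => gram E c w.1 v.1) ξ η

theorem gramForm_vec (c : B) (w v : Word E) (b d : B) :
    gramForm E c (vec E w b) (vec E v d) = star b * gram E c w.1 v.1 * d := form_vec E _ w v b d

theorem gramForm_add_left (c : B) (ξ ξ' η : AlgFock E) :
    gramForm E c (ξ + ξ') η = gramForm E c ξ η + gramForm E c ξ' η := form_add_left E _ ξ ξ' η

theorem gramForm_add_right (c : B) (ξ η η' : AlgFock E) :
    gramForm E c ξ (η + η') = gramForm E c ξ η + gramForm E c ξ η' := form_add_right E _ ξ η η'

theorem gramForm_sub_left (c : B) (ξ ξ' η : AlgFock E) :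
    gramForm E c (ξ - ξ') η = gramForm E c ξ η - gramForm E c ξ' η := by
  rw [eq_sub_iff_add_eq, ← gramForm_add_left, sub_add_cancel]

theorem gramForm_sub_right (c : B) (ξ η η' : AlgFock E) :
    gramForm E c ξ (η - η') = gramForm E c ξ η - gramForm E c ξ η' := by
  rw [eq_sub_iff_add_eq, ← gramForm_add_right, sub_add_cancel]

theorem gramForm_one (ξ η : AlgFock E) : gramForm E 1 ξ η = inner B ξ η := rfl

theorem gramForm_add (c d : B) (ξ η : AlgFock E) :
    gramForm E (c + d) ξ η = gramForm E c ξ η + gramForm E d ξ η := by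
  refine eq_of_vec E (g := fun ξ η => gramForm E c ξ η + gramForm E d ξ η)
    (gramForm_add_left E _) (gramForm_add_right E _) ?_ ?_ ?_ ξ η
  · intros; simp only [gramForm_add_left]; abel
  · intros; simp only [gramForm_add_right]; abel
  · intros; simp only [gramForm_vec, gram_add, mul_add, add_mul]

theorem gramForm_smul (z : ℂ) (c : B) (ξ η : AlgFock E) :
    gramForm E (z • c) ξ η = z • gramForm E c ξ η := by
  refine eq_of_vec E (g := fun ξ η => z • gramForm E c ξ η)
    (gramForm_add_left E _) (gramForm_add_right E _) ?_ ?_ ?_ ξ η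
  · intros; simp only [gramForm_add_left, smul_add]
  · intros; simp only [gramForm_add_right, smul_add]
  · intros; simp only [gramForm_vec, gram_smul, mul_smul_comm, smul_mul_assoc]

theorem gramForm_zero (ξ η : AlgFock E) : gramForm E 0 ξ η = 0 := by
  simpa using gramForm_smul E 0 0 ξ η

theorem gramForm_sum {J : Type*} (s : Finset J) (c : J → B) (ξ η : AlgFock E) :
    gramForm E (∑ j ∈ s, c j) ξ η = ∑ j ∈ s, gramForm E (c j) ξ η := by
  classical
  induction s using Finset.induction_on with
  | empty => simp [gramForm_zero]
  | insert j s hj ih => rw [Finset.sum_insert hj, Finset.sum_insert hj, gramForm_add, ih]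

/-- `⟨ξ, c η⟩` does not depend on the algebra `A i` in which `c : B` is taken. -/
theorem form_kernel_incl (i : I) (c : B) (ξ η : AlgFock E) :
    form E (kernel E i (ι i c)) ξ η = gramForm E c ξ η := by
  refine eq_of_vec E (form_add_left E _) (form_add_right E _) (gramForm_add_left E c)
    (gramForm_add_right E c) ?_ ξ η
  intro w v b d
  rw [form_vec, gramForm_vec]
  congr 2
  unfold kernel
  rcases first_rest_cases E i w.1 with ⟨x, w', hw, h1, h2⟩ | ⟨hw, h1, h2⟩ <;>
  rcases first_rest_cases E i v.1 with ⟨y, v', hv, h3, h4⟩ | ⟨hv, h3, h4⟩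
  -- If exactly one of the two words begins in `A i`, both sides vanish: the right by orthogonality
  -- of types, the left because `E i` is a `B`-bimodule map and kills the letter.
  · rw [h1, h2, h3, h4, hw, hv, gram_cons_self]
  · rw [h1, h2, h3, h4, hw, gram_cons_of_head E _ i _ _ _ hv, mul_one, (E i).map_mul_incl,
      map_star, (mem_meanZero (E i)).mp x.2, star_zero, zero_mul, gram_zero]
  · rw [h1, h2, h3, h4, hv, gram_of_head_cons E _ i _ _ _ hw, star_one, one_mul,
      (E i).map_incl_mul, (mem_meanZero (E i)).mp y.2, mul_zero, gram_zero]
  · rw [h1, h2, h3, h4, star_one, one_mul, mul_one, (E i).map_incl]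

/-- With `c = d* d`, the form is `⟨π_i(d) ξ, π_i(d) ξ⟩`. The index `i` is auxiliary: any of the
algebras serves to realise left multiplication by `d`. -/
theorem gramForm_nonneg (i : I) {c : B} (hc : 0 ≤ c) (ξ : AlgFock E) : 0 ≤ gramForm E c ξ ξ := by
  obtain ⟨d, rfl⟩ := CStarAlgebra.nonneg_iff_eq_star_mul_self.mp hc
  rw [← form_kernel_incl E i, map_mul, map_star, ← inner_preRep_preRep]
  exact inner_self_nonneg E _

/-- Positivity of the form for `‖c‖ - c`. This turns the sum of the `E_i(a_i* a_i)` into its norm.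
-/
theorem gramForm_le (i : I) {c : B} (hc : IsSelfAdjoint c) (ξ : AlgFock E) :
    gramForm E c ξ ξ ≤ (‖c‖ : ℂ) • inner B ξ ξ := by
  have h : 0 ≤ (‖c‖ : ℂ) • (1 : B) - c := by
    have := hc.le_algebraMap_norm_self
    rw [Algebra.algebraMap_eq_smul_one] at this
    rw [Complex.coe_smul]
    exact sub_nonneg.mpr this
  have h2 := gramForm_add E ((‖c‖ : ℂ) • (1 : B) - c) c ξ ξ
  rw [sub_add_cancel, gramForm_smul, gramForm_one] at h2
  rw [h2]
  exact le_add_of_nonneg_left (gramForm_nonneg E i h ξ)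

/-- The defect is `⟨π_i(d) ξ, π_i(d) ξ⟩` with `d* d = ‖a‖² - a* a`. Unlike `norm_preRep_le`, the
inequality stays in `B`, so that it can be summed over `i`. -/
theorem inner_preRep_self_le (i : I) (a : A i) (ξ : AlgFock E) :
    inner B (preRep E i a ξ) (preRep E i a ξ) ≤ ((‖a‖ ^ 2 : ℝ) : ℂ) • inner B ξ ξ := by
  have h1 : star a * a ≤ algebraMap ℝ (A i) (‖a‖ ^ 2) := by
    rw [sq, ← CStarRing.norm_star_mul_self]
    exact IsSelfAdjoint.le_algebraMap_norm_self (IsSelfAdjoint.star_mul_self a)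
  obtain ⟨d, hd⟩ := CStarAlgebra.nonneg_iff_eq_star_mul_self.mp (sub_nonneg.mpr h1)
  have h2 : inner B (preRep E i d ξ) (preRep E i d ξ) +
      inner B (preRep E i a ξ) (preRep E i a ξ) = ((‖a‖ ^ 2 : ℝ) : ℂ) • inner B ξ ξ := by
    rw [inner_preRep_preRep, inner_preRep_preRep, ← kernel_add, ← hd, sub_add_cancel,
      ← kernel_one E i, ← kernel_smul, Algebra.algebraMap_eq_smul_one, Complex.coe_smul]
  rw [← h2]; exact le_add_of_nonneg_left (inner_self_nonneg E _)

/-! ### The projections onto the words beginning in a given algebra -/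

open Classical in
/-- The projection onto the span of the words that begin with a letter from `A i`. -/
noncomputable def headProj (i : I) : AlgFock E →ₗ[ℂ] AlgFock E :=
  Finsupp.lsum ℂ fun w : Word E => if ∃ x ∈ w.1.head?, x.1 = i then vec E w else 0

open Classical in
theorem headProj_vec (i : I) (w : Word E) (b : B) :
    headProj E i (vec E w b) = if ∃ x ∈ w.1.head?, x.1 = i then vec E w b else 0 := by
  have : headProj E i (vec E w b) =
      (if ∃ x ∈ w.1.head?, x.1 = i then vec E w else 0 : B →ₗ[ℂ] AlgFock E) b := by
    unfold headProj
    exact Finsupp.lsum_single ..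
  rw [this]
  split_ifs <;> rfl

theorem headProj_headProj_self (i : I) (ξ : AlgFock E) :
    headProj E i (headProj E i ξ) = headProj E i ξ := by
  induction ξ using alg_induction with
  | h0 => simp
  | hadd ξ η h1 h2 => simp only [map_add, h1, h2]
  | hvec w b =>
    by_cases h : ∃ x ∈ w.1.head?, x.1 = i
    · rw [headProj_vec, if_pos h, headProj_vec, if_pos h]
    · rw [headProj_vec, if_neg h, map_zero]

/-- A word has at most one first letter. -/
theorem headProj_headProj_ne {i j : I} (hij : i ≠ j) (ξ : AlgFock E) :
    headProj E i (headProj E j ξ) = 0 := by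
  induction ξ using alg_induction with
  | h0 => simp
  | hadd ξ η h1 h2 => simp only [map_add, h1, h2, add_zero]
  | hvec w b =>
    by_cases h : ∃ x ∈ w.1.head?, x.1 = j
    · rw [headProj_vec, if_pos h, headProj_vec, if_neg]
      rintro ⟨y, hy, rfl⟩
      obtain ⟨x, hx, rfl⟩ := h
      exact hij (congrArg Sigma.fst (Option.mem_unique hy hx))
    · rw [headProj_vec, if_neg h, map_zero]

theorem gram_eq_zero_of_head (c : B) (i : I) {w v : List (Letter E)}
    (hw : ∃ x ∈ w.head?, x.1 = i) (hv : ¬ ∃ x ∈ v.head?, x.1 = i) : gram E c w v = 0 := by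
  rcases w with _ | ⟨⟨j, x⟩, w⟩
  · simp at hw
  · obtain rfl : j = i := by simpa using hw
    exact gram_cons_of_head E c j x w v fun y hy h => hv ⟨y, hy, h⟩

/-- For `c = 1` this is self-adjointness of `P_i`; for general `c` it also says that `P_i` commutes
with left multiplication by `B`, which does not change the index of the first factor. -/
theorem gramForm_headProj (c : B) (i : I) (ξ η : AlgFock E) :
    gramForm E c (headProj E i ξ) η = gramForm E c ξ (headProj E i η) := by
  have hl : ∀ η, gramForm E c 0 η = 0 := form_zero_left E _
  have hr : ∀ ξ, gramForm E c ξ 0 = 0 := form_zero_right E _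
  refine eq_of_vec E (f := fun ξ η => gramForm E c (headProj E i ξ) η)
    (g := fun ξ η => gramForm E c ξ (headProj E i η)) ?_ ?_ ?_ ?_ ?_ ξ η
  · intros; simp only [map_add, gramForm_add_left]
  · intros; simp only [gramForm_add_right]
  · intros; simp only [gramForm_add_left]
  · intros; simp only [map_add, gramForm_add_right]
  · intro w v b d
    simp only [headProj_vec]
    split_ifs with h1 h2 h2
    · rfl
    · rw [hr, gramForm_vec, gram_eq_zero_of_head E c i h1 h2, mul_zero, zero_mul]
    · rw [hl, gramForm_vec, ← star_star (gram E c w.1 v.1), gram_star,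
        gram_eq_zero_of_head E _ i h2 h1, star_zero, mul_zero, zero_mul]
    · rw [hl, hr]

theorem inner_headProj (i : I) (ξ η : AlgFock E) :
    inner B (headProj E i ξ) η = inner B ξ (headProj E i η) := gramForm_headProj E 1 i ξ η

/-- The projection onto the span of the words that do not begin with a letter from `A i`. -/
noncomputable def tailProj (i : I) : AlgFock E →ₗ[ℂ] AlgFock E := LinearMap.id - headProj E i

theorem tailProj_apply (i : I) (ξ : AlgFock E) : tailProj E i ξ = ξ - headProj E i ξ := rfl

theorem headProj_add_tailProj (i : I) (ξ : AlgFock E) : headProj E i ξ + tailProj E i ξ = ξ := by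
  rw [tailProj_apply, add_sub_cancel]

theorem tailProj_tailProj (i : I) (ξ : AlgFock E) :
    tailProj E i (tailProj E i ξ) = tailProj E i ξ := by
  simp only [tailProj_apply, map_sub, headProj_headProj_self, sub_self, sub_zero]

theorem gramForm_tailProj (c : B) (i : I) (ξ η : AlgFock E) :
    gramForm E c (tailProj E i ξ) η = gramForm E c ξ (tailProj E i η) := by
  simp only [tailProj_apply, gramForm_sub_left, gramForm_sub_right, gramForm_headProj]

theorem inner_tailProj (i : I) (ξ η : AlgFock E) :
    inner B (tailProj E i ξ) η = inner B ξ (tailProj E i η) := gramForm_tailProj E 1 i ξ η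

/-- There are no cross terms, because `P_i` and `Q_i` are complementary idempotents that can be
moved across the form. -/
theorem gramForm_eq_head_add_tail (c : B) (i : I) (ξ : AlgFock E) :
    gramForm E c ξ ξ = gramForm E c (headProj E i ξ) (headProj E i ξ) +
      gramForm E c (tailProj E i ξ) (tailProj E i ξ) := by
  rw [gramForm_headProj, gramForm_tailProj, headProj_headProj_self, tailProj_tailProj,
    ← gramForm_add_right, headProj_add_tailProj]

theorem inner_headProj_self_le (i : I) (ξ : AlgFock E) :
    inner B (headProj E i ξ) (headProj E i ξ) ≤ inner B ξ ξ := by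
  rw [← gramForm_one E ξ ξ, gramForm_eq_head_add_tail E 1 i ξ]
  exact le_add_of_nonneg_right (inner_self_nonneg E _)

/-- Dropping `Q_i` discards the term at `P_i ξ`, which is positive. It frees the creation estimate
from projections that depend on `i`, so that the coefficients in `B` can be added. -/
theorem gramForm_tailProj_self_le {c : B} (hc : 0 ≤ c) (i : I) (ξ : AlgFock E) :
    gramForm E c (tailProj E i ξ) (tailProj E i ξ) ≤ gramForm E c ξ ξ := by
  rw [gramForm_eq_head_add_tail E c i ξ]
  exact le_add_of_nonneg_left (gramForm_nonneg E i hc _)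

/-- Between words that do not begin in `A i`, the form of `π_i(a)` is that of `E(a)`. -/
theorem form_kernel_tailProj (i : I) (a : A i) (ξ η : AlgFock E) :
    form E (kernel E i a) (tailProj E i ξ) (tailProj E i η) =
      gramForm E (E i a) (tailProj E i ξ) (tailProj E i η) := by
  refine eq_of_vec E (f := fun ξ η => form E (kernel E i a) (tailProj E i ξ) (tailProj E i η))
    (g := fun ξ η => gramForm E (E i a) (tailProj E i ξ) (tailProj E i η)) ?_ ?_ ?_ ?_ ?_ ξ η
  · intros; simp only [map_add, form_add_left]
  · intros; simp only [map_add, form_add_right]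
  · intros; simp only [map_add, gramForm_add_left]
  · intros; simp only [map_add, gramForm_add_right]
  · intro w v b d
    simp only [tailProj_apply, headProj_vec]
    split_ifs with h1 h2 h2
    · simp only [sub_self, gramForm, form_zero_left]
    · simp only [sub_self, gramForm, form_zero_left]
    · simp only [sub_self, gramForm, form_zero_right]
    -- Nothing is split off from a word that does not begin in `A i`, so the kernel has `E(1* a 1)`
    -- as its coefficient.
    · have hw : ∀ w : Word E, (¬ ∃ x ∈ w.1.head?, x.1 = i) →
          first E i w.1 = 1 ∧ rest E i w.1 = w.1 := by
        intro w h
        rcases first_rest_cases E i w.1 with ⟨x, v, hx, -, -⟩ | ⟨-, h1, h2⟩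
        · exact absurd ⟨⟨i, x⟩, by simp [hx], rfl⟩ h
        · exact ⟨h1, h2⟩
      rw [sub_zero, sub_zero, form_vec, gramForm_vec, kernel, (hw w h1).1, (hw w h1).2,
        (hw v h2).1, (hw v h2).2, star_one, one_mul, mul_one]

/-! ### The diagonal part, the creation part and the annihilation part -/

theorem inner_zero_left (ξ : AlgFock E) : inner B (0 : AlgFock E) ξ = 0 := form_zero_left E _ ξ

theorem inner_zero_right (ξ : AlgFock E) : inner B ξ (0 : AlgFock E) = 0 := form_zero_right E _ ξ

theorem inner_sum_left {J : Type*} (s : Finset J) (ξ : J → AlgFock E) (η : AlgFock E) :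
    inner B (∑ j ∈ s, ξ j) η = ∑ j ∈ s, inner B (ξ j) η := by
  classical
  induction s using Finset.induction_on with
  | empty => simp [inner_zero_left]
  | insert j s hj ih => rw [Finset.sum_insert hj, Finset.sum_insert hj, inner_add_left, ih]

theorem inner_sum_right {J : Type*} (s : Finset J) (ξ : AlgFock E) (η : J → AlgFock E) :
    inner B ξ (∑ j ∈ s, η j) = ∑ j ∈ s, inner B ξ (η j) := by
  simp only [← star_inner E _ ξ, inner_sum_left, star_sum]

/-- Vectors in the ranges of the projections `headProj E i` are orthogonal. -/
theorem inner_sum_headProj (s : Finset I) (ξ : I → AlgFock E) :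
    inner B (∑ i ∈ s, headProj E i (ξ i)) (∑ i ∈ s, headProj E i (ξ i)) =
      ∑ i ∈ s, inner B (headProj E i (ξ i)) (headProj E i (ξ i)) := by
  rw [inner_sum_left]
  refine Finset.sum_congr rfl fun i hi => ?_
  rw [inner_sum_right, Finset.sum_eq_single_of_mem i hi]
  intro j _ hj
  rw [inner_headProj, headProj_headProj_ne E hj.symm, inner_zero_right]

/-- Bessel's inequality for the projections `headProj E i`. -/
theorem sum_inner_headProj_le (s : Finset I) (ξ : AlgFock E) :
    ∑ i ∈ s, inner B (headProj E i ξ) (headProj E i ξ) ≤ inner B ξ ξ := by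
  set η := ∑ i ∈ s, headProj E i ξ with hη
  have h1 : inner B η η = ∑ i ∈ s, inner B (headProj E i ξ) (headProj E i ξ) :=
    inner_sum_headProj E s fun _ => ξ
  have h2 : inner B ξ η = inner B η η := by
    rw [h1, hη, inner_sum_right]
    exact Finset.sum_congr rfl fun i _ => by rw [inner_headProj, headProj_headProj_self]
  have h3 : inner B η ξ = inner B η η := by rw [← star_inner, h2, star_inner]
  -- `η` is the orthogonal projection of `ξ` onto the sum of the ranges, and `ξ - η` is the
  -- remainder.
  have h4 := inner_self_nonneg E (ξ - η)
  rw [inner_sub_left, inner_sub_right, inner_sub_right, h2, h3, sub_self, sub_zero] at h4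
  rw [← h1]
  exact sub_nonneg.mp h4

theorem norm_le_of_inner_le {c : ℝ} (hc : 0 ≤ c) {ξ η : AlgFock E}
    (h : inner B ξ ξ ≤ ((c ^ 2 : ℝ) : ℂ) • inner B η η) : ‖ξ‖ ≤ c * ‖η‖ := by
  have h4 := CStarAlgebra.norm_le_norm_of_nonneg_of_le (inner_self_nonneg E ξ) h
  rw [norm_smul, ← norm_sq_eq, ← norm_sq_eq, Complex.norm_real, norm_pow, Real.norm_eq_abs,
    sq_abs, ← mul_pow] at h4
  exact le_of_sq_le_sq h4 (by positivity)

/-- Orthogonality of the ranges splits the square of the sum, each term is at most `M²` times the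
square of `P_i ξ`, and Bessel's inequality adds these up. -/
theorem norm_sum_diagonal_le (s : Finset I) (a : ∀ i, A i) {M : ℝ} (hM : ∀ i ∈ s, ‖a i‖ ≤ M)
    (hM0 : 0 ≤ M) (ξ : AlgFock E) :
    ‖∑ i ∈ s, headProj E i (preRep E i (a i) (headProj E i ξ))‖ ≤ M * ‖ξ‖ := by
  refine norm_le_of_inner_le E hM0 ?_
  rw [inner_sum_headProj, Complex.coe_smul]
  refine le_trans ?_ (smul_le_smul_of_nonneg_left (sum_inner_headProj_le E s ξ) (sq_nonneg M))
  rw [Finset.smul_sum]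
  refine Finset.sum_le_sum fun i hi => ?_
  refine (inner_headProj_self_le E i _).trans ((inner_preRep_self_le E i _ _).trans ?_)
  rw [Complex.coe_smul]
  exact smul_le_smul_of_nonneg_right (pow_le_pow_left₀ (norm_nonneg _) (hM i hi) 2)
    (inner_self_nonneg E _)

/-- After orthogonality removes the cross terms, the compression of `π_i(a_i* a_i)` by `Q_i` only
sees `E_i(a_i* a_i)`. Mean zero plays no role. -/
theorem norm_sum_creation_le (s : Finset I) (a : ∀ i, A i) (ξ : AlgFock E) :
    ‖∑ i ∈ s, headProj E i (preRep E i (a i) (tailProj E i ξ))‖ ≤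
      √‖∑ i ∈ s, E i (star (a i) * a i)‖ * ‖ξ‖ := by
  -- `gramForm_le` requires an auxiliary index; any `j` in `s` will do.
  rcases s.eq_empty_or_nonempty with rfl | ⟨j, -⟩
  · simp
  have hpos : ∀ i, 0 ≤ E i (star (a i) * a i) := fun i =>
    map_nonneg (E i).toPositiveLinearMap (star_mul_self_nonneg (a i))
  refine norm_le_of_inner_le E (Real.sqrt_nonneg _) ?_
  rw [inner_sum_headProj, Real.sq_sqrt (norm_nonneg _)]
  refine le_trans ?_ (gramForm_le E j
    (IsSelfAdjoint.of_nonneg (Finset.sum_nonneg fun i _ => hpos i)) ξ)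
  rw [gramForm_sum]
  refine Finset.sum_le_sum fun i _ => ?_
  refine (inner_headProj_self_le E i _).trans ?_
  rw [inner_preRep_preRep, form_kernel_tailProj]
  exact gramForm_tailProj_self_le E (hpos i) i ξ

/-- Duality: pairing the sum `η` with itself moves the operators onto one copy of `η`, where they
form the creation sum for the `a_i*`; one factor `‖η‖` then cancels. -/
theorem norm_sum_annihilation_le (s : Finset I) (a : ∀ i, A i) (ξ : AlgFock E) :
    ‖∑ i ∈ s, tailProj E i (preRep E i (a i) (headProj E i ξ))‖ ≤
      √‖∑ i ∈ s, E i (a i * star (a i))‖ * ‖ξ‖ := by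
  set η := ∑ i ∈ s, tailProj E i (preRep E i (a i) (headProj E i ξ)) with hη
  have h1 : inner B η η =
      inner B (∑ i ∈ s, headProj E i (preRep E i (star (a i)) (tailProj E i η))) ξ := by
    -- Only the second copy of `η` is expanded; the first receives the adjoints.
    conv_lhs => enter [3]; rw [hη]
    rw [inner_sum_right, inner_sum_left]
    refine Finset.sum_congr rfl fun i _ => ?_
    rw [← inner_tailProj, inner_headProj, inner_preRep_left]
  have h2 := norm_sum_creation_le E s (fun i => star (a i)) η
  simp only [star_star] at h2
  have h3 : ‖η‖ * ‖η‖ ≤ (√‖∑ i ∈ s, E i (a i * star (a i))‖ * ‖ξ‖) * ‖η‖ := by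
    rw [← sq, norm_sq_eq, h1]
    refine (norm_inner_le E _ _).trans ((mul_le_mul_of_nonneg_right h2 (norm_nonneg ξ)).trans ?_)
    rw [mul_right_comm]
  rcases (norm_nonneg η).eq_or_lt with h | h
  · rw [← h]; positivity
  · exact le_of_mul_le_mul_right h3 h

/-- Only the seminorm vanishes: the vector itself can be a nonzero formal sum, such as a word whose
first letter is `0`. -/
theorem norm_tailProj_preRep_tailProj {i : I} {a : A i} (ha : E i a = 0) (ξ : AlgFock E) :
    ‖tailProj E i (preRep E i a (tailProj E i ξ))‖ = 0 := by
  rw [← sq_eq_zero_iff, norm_sq_eq, inner_tailProj, tailProj_tailProj, ← inner_tailProj,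
    inner_preRep, form_kernel_tailProj, ha, gramForm_zero, norm_zero]

/-! ### Sum of the four blocks and passage to the completion -/

theorem norm_sum_preRep_le (s : Finset I) (a : ∀ i, A i) (ha : ∀ i ∈ s, E i (a i) = 0) {M : ℝ}
    (hM : ∀ i ∈ s, ‖a i‖ ≤ M) (hM0 : 0 ≤ M) (ξ : AlgFock E) :
    ‖∑ i ∈ s, preRep E i (a i) ξ‖ ≤ (M + √‖∑ i ∈ s, E i (star (a i) * a i)‖ +
      √‖∑ i ∈ s, E i (a i * star (a i))‖) * ‖ξ‖ := by
  have h : ∑ i ∈ s, preRep E i (a i) ξ =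
      ∑ i ∈ s, headProj E i (preRep E i (a i) (headProj E i ξ)) +
      ∑ i ∈ s, headProj E i (preRep E i (a i) (tailProj E i ξ)) +
      ∑ i ∈ s, tailProj E i (preRep E i (a i) (headProj E i ξ)) +
      ∑ i ∈ s, tailProj E i (preRep E i (a i) (tailProj E i ξ)) := by
    simp only [← Finset.sum_add_distrib]
    refine Finset.sum_congr rfl fun i _ => ?_
    rw [← map_add, ← map_add, add_assoc, ← map_add, ← map_add, headProj_add_tailProj,
      headProj_add_tailProj]
  have h0 : ‖∑ i ∈ s, tailProj E i (preRep E i (a i) (tailProj E i ξ))‖ ≤ 0 :=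
    (norm_sum_le _ _).trans
      (Finset.sum_eq_zero fun i hi => norm_tailProj_preRep_tailProj E (ha i hi) ξ).le
  rw [h, add_mul, add_mul]
  refine (norm_add_le _ _).trans ((add_le_add norm_add₃_le h0).trans ?_)
  rw [add_zero]
  exact add_le_add (add_le_add (norm_sum_diagonal_le E s a hM hM0 ξ)
    (norm_sum_creation_le E s a ξ)) (norm_sum_annihilation_le E s a ξ)

theorem norm_sum_rep_le (s : Finset I) (a : ∀ i, A i) (ha : ∀ i ∈ s, E i (a i) = 0) {M : ℝ}
    (hM : ∀ i ∈ s, ‖a i‖ ≤ M) (hM0 : 0 ≤ M) :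
    ‖∑ i ∈ s, rep E i (a i)‖ ≤ M + √‖∑ i ∈ s, E i (star (a i) * a i)‖ +
      √‖∑ i ∈ s, E i (a i * star (a i))‖ := by
  have h : ((∑ i ∈ s, rep E i (a i) : adjointable E) : Fock E →L[ℂ] Fock E) =
      ∑ i ∈ s, repCLM E i (a i) := by
    rw [AddSubmonoidClass.coe_finsetSum]; rfl
  change ‖((∑ i ∈ s, rep E i (a i) : adjointable E) : Fock E →L[ℂ] Fock E)‖ ≤ _
  rw [h]
  refine ContinuousLinearMap.opNorm_le_bound _ (by positivity) fun x => ?_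
  -- The bound is a closed condition on `x`, so the dense image of the algebraic Fock space
  -- suffices.
  induction x using UniformSpace.Completion.induction_on with
  | hp => exact isClosed_le (by fun_prop) (by fun_prop)
  | ih ξ =>
    have : (∑ i ∈ s, repCLM E i (a i)) (ξ : Fock E) =
        ((∑ i ∈ s, preRep E i (a i) ξ : AlgFock E) : Fock E) := by
      rw [_root_.sum_apply]
      simp only [repCLM_coe]
      exact (map_sum (UniformSpace.Completion.toCompl (α := AlgFock E)) _ s).symm
    rw [this, UniformSpace.Completion.norm_coe, UniformSpace.Completion.norm_coe]
    exact norm_sum_preRep_le E s a ha hM hM0 ξ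

end FreeProduct

theorem mainTheorem8 {B : Type*} [CStarAlgebra B] [PartialOrder B] [StarOrderedRing B]
    [WStarAlgebra B] {I : Type*} {A : I → Type*} [∀ i, CStarAlgebra (A i)]
    [∀ i, PartialOrder (A i)] [∀ i, StarOrderedRing (A i)] [∀ i, WStarAlgebra (A i)]
    (ι : ∀ i, B →⋆ₐ[ℂ] A i) (E : ∀ i, ConditionalExpectation (ι i))
    (hfaithful : ∀ i, (E i).IsFaithful) (hnormal : ∀ i, (E i).IsNormal)
    (a : ∀ i, A i) (ha : ∀ i, a i ∈ (E i).meanZero) (hfin : {i | a i ≠ 0}.Finite) :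
    ‖∑ i ∈ hfin.toFinset, FreeProduct.rep E i (a i)‖ ≤
      (⨆ i, ‖a i‖) + √‖∑ i ∈ hfin.toFinset, E i (star (a i) * a i)‖ +
        √‖∑ i ∈ hfin.toFinset, E i (a i * star (a i))‖ := by
  have hbdd : BddAbove (Set.range fun i => ‖a i‖) := by
    -- The norms take finitely many values; `0` accounts for the indices outside the support.
    -- Without boundedness the real supremum would default to `0`.
    refine (((hfin.image fun i => ‖a i‖).insert 0).subset ?_).bddAbove
    rintro _ ⟨i, rfl⟩
    by_cases h : a i = 0
    · left; simp [h]
    · right; exact ⟨i, h, rfl⟩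
  exact FreeProduct.norm_sum_rep_le E hfin.toFinset a
    (fun i _ => (ConditionalExpectation.mem_meanZero (E i)).mp (ha i))
    (fun i _ => le_ciSup hbdd i) (Real.iSup_nonneg fun i => norm_nonneg _)
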